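/- Let $R=\mathbb Z[\xi_1,\xi_2]$ be the polynomial ring in two indeterminates, and let $\mathcal H$ be the Hecke algebra of the complex reflection group $G_4=\langle s,t\mid s^3=t^3=1,\ sts=tst\rangle$, that is, the associative unital $R$-algebra generated by $\tilde T_s,\tilde T_t$ subject to the relations \[\tilde T_s\tilde T_t\tilde T_s=\tilde T_t\tilde T_s\tilde T_t,\qquad \tilde T_x^3=1+\xi_1\tilde T_x+\xi_2\tilde T_x^2\quad(x\in\{s,t\}).\] For a word $w=x_1\cdots x_k$ in $s,t$ write $\tilde T_w=\tilde T_{x_1}\cdots\tilde T_{x_k}$, with $\tilde T_1=1$ for the empty word. Then the $24$ elements \begin{multline*} B_{sts}=\{\tilde T_1, \tilde T_s, \tilde T_t, \tilde T_{s^2}, \tilde T_{t^2}, \tilde T_{st}, \tilde T_{ts}, \tilde T_{st^2}, \tilde T_{t^2s}, \tilde T_{s^2t}, \tilde T_{ts^2}, \tilde T_{s^2t^2}, \tilde T_{t^2s^2}, \tilde T_{st^2s},\\ \tilde T_{ts^2t}, \tilde T_{s^2ts^2}, \tilde T_{t^2st^2}, \tilde T_{ststst}, \tilde T_{sts}, \tilde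 T_{sts^2}, \tilde T_{s^2ts}, \tilde T_{s^2t^2s}, \tilde T_{st^2s^2}, \tilde T_{s^2t^2s^2}\} \end{multline*} form an $R$-basis of $\mathcal H$, and the following seven elements $b_1,\dots,b_7$, written in this basis, form an $R$-basis of the centre $Z(\mathcal H)$: \begin{align*} b_1 &=\tilde T_1,\\ b_2 &=\tilde T_{ststst},\\ b_3 &=\tilde T_s+\tilde T_t+\tilde T_{s^2ts}+\tilde T_{sts^2}-\xi_2\tilde T_{sts},\\ b_4 &=\tilde T_{ts}+\tilde T_{st}+\tilde T_{s^2ts^2}+\tilde T_{t^2st^2}+\xi_1\tilde T_{sts},\\ b_5 &=\tilde T_{s^2}+\tilde T_{t^2}+\tilde T_{st^2s^2}+\tilde T_{s^2t^2s}+\xi_1^2(\tilde T_{sts^2}+\tilde T_{s^2ts})+\xi_1(\tilde T_{s^2t}+\tilde T_{ts^2})\\ &\quad+\xi_1\tilde T_{sts}+\xi_2(\tilde T_{ts^2t}-\tilde T_{st^2s})+\xi_1\xi_2(\tilde T_{t^2st^2}+\tilde T_{s^2ts^2}),\\ b_6 &=\tilde T_{ts^2}+\tilde T_{s^2t}+\tilde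 T_{sts}+\tilde T_{st^2}+\tilde T_{t^2s}+\tilde T_{s^2t^2s^2}+\xi_2\tilde T_{t^2st^2}+\xi_2^2\tilde T_{ts^2t}+\xi_1\tilde T_t\\ &\quad+(2\xi_1+\xi_1^2\xi_2)(\tilde T_{s^2ts}+\tilde T_{sts^2})+\xi_1\xi_2(\tilde T_{ts^2}+\tilde T_{s^2t})+\xi_1(\tilde T_{st^2s}+\tilde T_{ts^2t})\\ &\quad+\xi_2(1+\xi_1\xi_2)(\tilde T_{s^2ts^2}+\tilde T_{t^2st^2}),\\ b_7 &=\tilde T_{ts^2t}+\tilde T_{s^2t^2}+\tilde T_{t^2s^2}+\tilde T_{st^2s}+\xi_2\tilde T_{s^2t^2s^2}+\xi_1(\xi_1+\xi_2^2)(\tilde T_{ts^2}+\tilde T_{s^2t})\\ &\quad+\xi_1(\xi_1^2+\xi_2+\xi_1\xi_2^2)(\tilde T_{sts^2}+\tilde T_{s^2ts})+\xi_1(\tilde T_{st^2s^2}+\tilde T_{s^2t^2s})+\xi_1\xi_2\tilde T_t\\ &\quad+\xi_1^2\tilde T_{sts}+\xi_2(2\xi_1+\xi_2^2)\tilde T_{ts^2t}+\xi_2(\xi_2+\xi_1^2+\xi_1\xi_2^2)\tilde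 T_{t^2st^2}\\ &\quad+\xi_1\xi_2(\xi_1+\xi_2^2)\tilde T_{s^2ts^2}. \end{align*} -/

import Mathlib

/-! The Hecke algebra of the complex reflection group
`G₄ = ⟨s, t | s³ = t³ = 1, sts = tst⟩` over `R = ℤ[ξ₁, ξ₂]`. -/

namespace HeckeG4

/-- The two generating pseudo-reflections of `G₄`. -/
inductive Gen : Type
  | s
  | t

/-- The ground ring `R = ℤ[ξ₁, ξ₂]`, a polynomial ring in two indeterminates. -/
abbrev R : Type := MvPolynomial (Fin 2) ℤ

/-- The indeterminate `ξ₁`. -/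
noncomputable def ξ₁ : R := MvPolynomial.X 0

/-- The indeterminate `ξ₂`. -/
noncomputable def ξ₂ : R := MvPolynomial.X 1

/-- The defining relations: the order relation `x³ = 1 + ξ₁ x + ξ₂ x²` for each generator `x`,
and the braid relation `sts = tst`. -/
inductive Rel : FreeAlgebra R Gen → FreeAlgebra R Gen → Prop
  | order (x : Gen) :
      Rel (FreeAlgebra.ι R x ^ 3) (1 + ξ₁ • FreeAlgebra.ι R x + ξ₂ • FreeAlgebra.ι R x ^ 2)
  | braid :
      Rel (FreeAlgebra.ι R Gen.s * FreeAlgebra.ι R Gen.t * FreeAlgebra.ι R Gen.s)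
        (FreeAlgebra.ι R Gen.t * FreeAlgebra.ι R Gen.s * FreeAlgebra.ι R Gen.t)

/-- The Hecke algebra `H` of `G₄`: the associative unital `R`-algebra presented by the generators
`T_s`, `T_t` and the relations `Rel`. -/
abbrev H : Type := RingQuot Rel

/-- The generator `T_x` of `H`. -/
noncomputable def gen (x : Gen) : H := RingQuot.mkAlgHom R Rel (FreeAlgebra.ι R x)

/-- `T w` is the product of the generators along the word `w`;
for instance `T [s, s, t, s] = T_s T_s T_t T_s`. -/
noncomputable def T (w : List Gen) : H := (w.map gen).prod

section Words

open Gen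

/-- The words indexing the basis `B_sts`. -/
def wordsSts : Fin 24 → List Gen :=
  ![[], [s], [t], [s, s], [t, t], [s, t], [t, s], [s, t, t], [t, t, s], [s, s, t], [t, s, s],
    [s, s, t, t], [t, t, s, s], [s, t, t, s],
    [t, s, s, t], [s, s, t, s, s], [t, t, s, t, t], [s, t, s, t, s, t],
    [s, t, s], [s, t, s, s], [s, s, t, s], [s, s, t, t, s], [s, t, t, s, s], [s, s, t, t, s, s]]

/-- The family `B_sts`. -/
noncomputable def Bsts (i : Fin 24) : H := T (wordsSts i)

noncomputable def b₁ : H := T []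

noncomputable def b₂ : H := T [s, t, s, t, s, t]

noncomputable def b₃ : H :=
  T [s] + T [t] + T [s, s, t, s] + T [s, t, s, s] - ξ₂ • T [s, t, s]

noncomputable def b₄ : H :=
  T [t, s] + T [s, t] + T [s, s, t, s, s] + T [t, t, s, t, t] + ξ₁ • T [s, t, s]

noncomputable def b₅ : H :=
  T [s, s] + T [t, t] + T [s, t, t, s, s] + T [s, s, t, t, s]
    + ξ₁ ^ 2 • (T [s, t, s, s] + T [s, s, t, s]) + ξ₁ • (T [s, s, t] + T [t, s, s])
    + ξ₁ • T [s, t, s] + ξ₂ • (T [t, s, s, t] - T [s, t, t, s])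
    + (ξ₁ * ξ₂) • (T [t, t, s, t, t] + T [s, s, t, s, s])

noncomputable def b₆ : H :=
  T [t, s, s] + T [s, s, t] + T [s, t, s] + T [s, t, t] + T [t, t, s] + T [s, s, t, t, s, s]
    + ξ₂ • T [t, t, s, t, t] + ξ₂ ^ 2 • T [t, s, s, t] + ξ₁ • T [t]
    + (2 * ξ₁ + ξ₁ ^ 2 * ξ₂) • (T [s, s, t, s] + T [s, t, s, s])
    + (ξ₁ * ξ₂) • (T [t, s, s] + T [s, s, t]) + ξ₁ • (T [s, t, t, s] + T [t, s, s, t])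
    + (ξ₂ * (1 + ξ₁ * ξ₂)) • (T [s, s, t, s, s] + T [t, t, s, t, t])

noncomputable def b₇ : H :=
  T [t, s, s, t] + T [s, s, t, t] + T [t, t, s, s] + T [s, t, t, s]
    + ξ₂ • T [s, s, t, t, s, s] + (ξ₁ * (ξ₁ + ξ₂ ^ 2)) • (T [t, s, s] + T [s, s, t])
    + (ξ₁ * (ξ₁ ^ 2 + ξ₂ + ξ₁ * ξ₂ ^ 2)) • (T [s, t, s, s] + T [s, s, t, s])
    + ξ₁ • (T [s, t, t, s, s] + T [s, s, t, t, s]) + (ξ₁ * ξ₂) • T [t]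
    + ξ₁ ^ 2 • T [s, t, s] + (ξ₂ * (2 * ξ₁ + ξ₂ ^ 2)) • T [t, s, s, t]
    + (ξ₂ * (ξ₂ + ξ₁ ^ 2 + ξ₁ * ξ₂ ^ 2)) • T [t, t, s, t, t]
    + (ξ₁ * ξ₂ * (ξ₁ + ξ₂ ^ 2)) • T [s, s, t, s, s]

/-- The family `b₁, …, b₇`. -/
noncomputable def b : Fin 7 → H := ![b₁, b₂, b₃, b₄, b₅, b₆, b₇]

end Words

end HeckeG4

/-! Left multiplication by each generator is written as an explicit 24 × 24 matrix on coordinates.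
The map `combSts` from coordinate vectors to `H` intertwines these matrices with actual
multiplication (`combSts_regular`), so its image is a left ideal containing 1, hence all of `H`. For
independence, the matrices themselves satisfy the defining relations (`isHeckePair_left`) and
therefore define a representation `regular` of `H` on R²⁴. Applying the image of `combSts v` to the
first unit vector returns `v` (`regular_combSts`), so `combSts` is injective.

With coordinates available, an element is central exactly when left and right multiplication by each
generator agree on its coordinates (`combSts_mem_center_iff`). This linear system is solved over `R`
without division: seven coordinates are free and determine the other seventeen (`eq_centralCoords`).
The resulting parametrisation by R⁷ is that of the combinations of the `b i`
(`combSts_centralCoords`). -/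

namespace HeckeG4

set_option linter.unusedSimpArgs false

/-! ### Rewriting rules derived from the order and braid relations. -/

section Relations

variable {A : Type*} [Ring A] [Algebra R A]

/-- The elements `s`, `t` of an `R`-algebra satisfy the defining relations of `H`. -/
structure IsHeckePair (s t : A) : Prop where
  order_left : s * (s * s) = 1 + ξ₁ • s + ξ₂ • (s * s)
  order_right : t * (t * t) = 1 + ξ₁ • t + ξ₂ • (t * t)
  braid : t * (s * t) = s * (t * s)

/-- The cubic has constant term 1, so the inverse is s² - ξ₂ s - ξ₁. -/
theorem isUnit_of_order {s : A} (h : s * (s * s) = 1 + ξ₁ • s + ξ₂ • (s * s)) : IsUnit s := by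
  have h₁ : s * (s * s - ξ₁ • 1 - ξ₂ • s) = 1 := by
    simp only [mul_sub, mul_smul_comm, mul_one, h]
    abel
  have h₂ : (s * s - ξ₁ • 1 - ξ₂ • s) * s = 1 := by
    simp only [sub_mul, smul_mul_assoc, one_mul, mul_assoc, h]
    abel
  exact ⟨⟨s, _, h₁, h₂⟩, rfl⟩

namespace IsHeckePair

variable {s t : A}

theorem symm (h : IsHeckePair s t) : IsHeckePair t s :=
  ⟨h.order_right, h.order_left, h.braid.symm⟩

theorem order_left_mul (h : IsHeckePair s t) (z : A) :
    s * (s * (s * z)) = z + ξ₁ • (s * z) + ξ₂ • (s * (s * z)) := by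
  have := congrArg (· * z) h.order_left
  simpa only [add_mul, smul_mul_assoc, one_mul, mul_assoc] using this

theorem order_right_mul (h : IsHeckePair s t) (z : A) :
    t * (t * (t * z)) = z + ξ₁ • (t * z) + ξ₂ • (t * (t * z)) :=
  h.symm.order_left_mul z

theorem braid_mul (h : IsHeckePair s t) (z : A) : t * (s * (t * z)) = s * (t * (s * z)) := by
  have := congrArg (· * z) h.braid
  simpa only [mul_assoc] using this

theorem tssts (h : IsHeckePair s t) : t * (s * (s * (t * s))) = s * (t * (s * (s * t))) := by
  rw [← h.braid, h.braid_mul]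

theorem tssts_mul (h : IsHeckePair s t) (z : A) :
    t * (s * (s * (t * (s * z)))) = s * (t * (s * (s * (t * z)))) := by
  rw [← h.braid_mul, h.braid_mul]

/-- The braid relation says s⁻¹ts = tst⁻¹, and squaring gives s⁻¹t²s = ts²t⁻¹. Expanding both
inverses as quadratic polynomials yields this rule. -/
theorem tsstt (h : IsHeckePair s t) :
    t * (s * (s * (t * t))) = s * (s * (t * (t * s))) + ξ₂ • (t * (s * (s * t)))
      - ξ₂ • (s * (t * (t * s))) - ξ₁ • (t * (t * s)) + ξ₁ • (t * (s * s)) := by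
  -- Multiplying s⁻¹t²s = ts²t⁻¹ by s on the left and t on the right leaves t²st = sts², a
  -- consequence of the braid relation; the two units are then cancelled.
  have key : s * ((s * (s * (t * (t * s))) - ξ₂ • (s * (t * (t * s))) - ξ₁ • (t * (t * s))) * t) =
      s * ((t * (s * (s * (t * t))) - ξ₂ • (t * (s * (s * t))) - ξ₁ • (t * (s * s))) * t) := by
    simp only [sub_mul, smul_mul_assoc, mul_sub, mul_add, mul_smul_comm, mul_assoc,
      h.order_left_mul, h.order_right, h.braid, h.braid_mul, mul_one]
    abel
  have := (isUnit_of_order h.order_right).mul_right_cancel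
    ((isUnit_of_order h.order_left).mul_left_cancel key)
  rw [eq_comm, sub_eq_iff_eq_add, sub_eq_iff_eq_add] at this
  rw [this]
  abel

theorem ttsst (h : IsHeckePair s t) :
    t * (t * (s * (s * t))) = s * (t * (t * (s * s))) + ξ₂ • (t * (s * (s * t)))
      - ξ₂ • (s * (t * (t * s))) - ξ₁ • (s * (t * t)) + ξ₁ • (s * (s * t)) := by
  rw [h.symm.tsstt]
  abel

theorem tsstt_mul (h : IsHeckePair s t) (z : A) :
    t * (s * (s * (t * (t * z)))) = s * (s * (t * (t * (s * z)))) + ξ₂ • (t * (s * (s * (t * z))))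
      - ξ₂ • (s * (t * (t * (s * z)))) - ξ₁ • (t * (t * (s * z))) + ξ₁ • (t * (s * (s * z))) := by
  have := congrArg (· * z) h.tsstt
  simpa only [add_mul, sub_mul, smul_mul_assoc, mul_assoc] using this

end IsHeckePair
end Relations

/-! ### Coordinates and the multiplication matrices. -/

/-- The monomials of `wordsSts`, in normal form. -/
def monomials {A : Type*} [Ring A] (s t : A) : Fin 24 → A :=
  ![
    1, s, t, s * s, t * t, s * t, t * s, s * (t * t), t * (t * s), s * (s * t), t * (s * s),
    s * (s * (t * t)), t * (t * (s * s)), s * (t * (t * s)), t * (s * (s * t)),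
    s * (s * (t * (s * s))), s * (t * (s * (s * t))), s * (s * (t * (s * (s * t)))), s * (t * s),
    s * (t * (s * s)), s * (s * (t * s)), s * (s * (t * (t * s))), s * (t * (t * (s * s))),
    s * (s * (t * (t * (s * s))))]

/-- The coordinate forms on `R²⁴`. -/
noncomputable def coord (j : Fin 24) : (Fin 24 → R) →ₗ[R] R := LinearMap.proj j

@[simp]
theorem coord_apply (j : Fin 24) (v : Fin 24 → R) : coord j v = v j := rfl

/-- The matrix of left multiplication by `T_s` in the basis `B_sts`. -/
noncomputable def leftS : Module.End R (Fin 24 → R) :=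
  LinearMap.pi ![
    coord 3, coord 0 + ξ₁ • coord 3, coord 9, coord 1 + ξ₂ • coord 3, coord 11,
    coord 2 + ξ₁ • coord 9, coord 20, coord 4 + ξ₁ • coord 11, coord 21, coord 5 + ξ₂ • coord 9,
    coord 15, coord 7 + ξ₂ • coord 11, coord 23, coord 8 + ξ₁ • coord 21, coord 17,
    ξ₂ • coord 15 + coord 19, coord 14 + ξ₁ • coord 17, coord 16 + ξ₂ • coord 17,
    coord 6 + ξ₁ • coord 20, coord 10 + ξ₁ • coord 15, coord 18 + ξ₂ • coord 20,
    coord 13 + ξ₂ • coord 21, coord 12 + ξ₁ • coord 23, coord 22 + ξ₂ • coord 23]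

/-- The matrix of left multiplication by `T_t` in the basis `B_sts`. -/
noncomputable def leftT : Module.End R (Fin 24 → R) :=
  LinearMap.pi ![
    coord 4, coord 8, coord 0 + ξ₁ • coord 4 + ξ₁ • coord 21 + (ξ₁ * ξ₂) • coord 23, coord 12,
    coord 2 + ξ₂ • coord 4 - ξ₁ • coord 23, coord 19,
    coord 1 + ξ₁ • coord 8 + (ξ₁ ^ 2) • coord 21 + (ξ₁ + ξ₁ ^ 2 * ξ₂) • coord 23,
    coord 16 - ξ₁ • coord 14 - ξ₂ • coord 23,
    coord 6 + ξ₂ • coord 8 - ξ₁ • coord 11 - (ξ₁ ^ 2) • coord 23, ξ₁ • coord 14 + coord 22,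
    coord 3 + ξ₁ • coord 11 + ξ₁ • coord 12 + (ξ₁ * ξ₂) • coord 21 + (ξ₁ * ξ₂ ^ 2 +
      ξ₁ ^ 2) • coord 23,
    coord 23, coord 10 + ξ₂ • coord 12 - ξ₁ • coord 21 - (ξ₁ * ξ₂) • coord 23,
    coord 17 - ξ₂ • coord 11 - ξ₂ • coord 14 - (ξ₁ * ξ₂) • coord 23,
    coord 9 + ξ₂ • coord 11 + ξ₂ • coord 14, coord 13 + ξ₁ • coord 17 + ξ₂ • coord 22,
    ξ₂ • coord 16 + coord 20 + ξ₂ • coord 21, coord 15 + ξ₂ • coord 17 + ξ₂ • coord 23,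
    coord 5 + ξ₁ • coord 19, coord 18 + ξ₂ • coord 19, coord 7 + ξ₁ • coord 16 + ξ₁ • coord 22,
    coord 11 + ξ₁ • coord 23, coord 14 - ξ₂ • coord 21 - (ξ₂ ^ 2) • coord 23,
    coord 21 + ξ₂ • coord 23]

/-- The matrix of right multiplication by `T_s` in the basis `B_sts`. -/
noncomputable def rightS : Module.End R (Fin 24 → R) :=
  LinearMap.pi ![
    coord 3, coord 0 + ξ₁ • coord 3, coord 10, coord 1 + ξ₂ • coord 3, coord 12, coord 19,
    coord 2 + ξ₁ • coord 10, coord 22, coord 4 + ξ₁ • coord 12, coord 15, coord 6 + ξ₂ • coord 10,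
    coord 23, coord 8 + ξ₂ • coord 12, coord 7 + ξ₁ • coord 22, coord 17,
    ξ₂ • coord 15 + coord 20, coord 14 + ξ₁ • coord 17, coord 16 + ξ₂ • coord 17,
    coord 5 + ξ₁ • coord 19, coord 18 + ξ₂ • coord 19, coord 9 + ξ₁ • coord 15,
    coord 11 + ξ₁ • coord 23, coord 13 + ξ₂ • coord 22, coord 21 + ξ₂ • coord 23]

/-- The matrix of right multiplication by `T_t` in the basis `B_sts`. -/
noncomputable def rightT : Module.End R (Fin 24 → R) :=
  LinearMap.pi ![
    coord 4, coord 7, coord 0 + ξ₁ • coord 4 + ξ₁ • coord 22 + (ξ₁ * ξ₂) • coord 23, coord 11,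
    coord 2 + ξ₂ • coord 4 - ξ₁ • coord 23,
    coord 1 + ξ₁ • coord 7 + (ξ₁ ^ 2) • coord 22 + (ξ₁ + ξ₁ ^ 2 * ξ₂) • coord 23, coord 20,
    coord 5 + ξ₂ • coord 7 - ξ₁ • coord 12 - (ξ₁ ^ 2) • coord 23,
    coord 16 - ξ₁ • coord 14 - ξ₂ • coord 23,
    coord 3 + ξ₁ • coord 11 + ξ₁ • coord 12 + (ξ₁ * ξ₂) • coord 22 + (ξ₁ * ξ₂ ^ 2 +
      ξ₁ ^ 2) • coord 23,
    ξ₁ • coord 14 + coord 21, coord 9 + ξ₂ • coord 11 - ξ₁ • coord 22 - (ξ₁ * ξ₂) • coord 23,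
    coord 23, coord 17 - ξ₂ • coord 12 - ξ₂ • coord 14 - (ξ₁ * ξ₂) • coord 23,
    coord 10 + ξ₂ • coord 12 + ξ₂ • coord 14, coord 13 + ξ₁ • coord 17 + ξ₂ • coord 21,
    ξ₂ • coord 16 + coord 19 + ξ₂ • coord 22, coord 15 + ξ₂ • coord 17 + ξ₂ • coord 23,
    coord 6 + ξ₁ • coord 20, coord 8 + ξ₁ • coord 16 + ξ₁ • coord 21, coord 18 + ξ₂ • coord 20,
    coord 14 - ξ₂ • coord 22 - (ξ₂ ^ 2) • coord 23, coord 12 + ξ₁ • coord 23,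
    coord 22 + ξ₂ • coord 23]

/-- The coordinates of `∑ i, p i • b i` in the basis `B_sts`. -/
noncomputable def centralCoords (p : Fin 7 → R) : Fin 24 → R :=
  ![
    p 0, p 2, p 2 + ξ₁ * p 5 + ξ₁ * ξ₂ * p 6, p 4, p 4, p 3, p 3, p 5, p 5,
    ξ₁ * p 4 + (1 + ξ₁ * ξ₂) * p 5 + (ξ₁ * ξ₂ ^ 2 + ξ₁ ^ 2) * p 6,
    ξ₁ * p 4 + (1 + ξ₁ * ξ₂) * p 5 + (ξ₁ * ξ₂ ^ 2 + ξ₁ ^ 2) * p 6, p 6, p 6,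
    ξ₁ * p 5 + p 6 - ξ₂ * p 4, ξ₂ * p 4 + (ξ₂ ^ 2 + ξ₁) * p 5 + (1 + ξ₂ ^ 3 + 2 * ξ₁ * ξ₂) * p 6,
    p 3 + ξ₁ * ξ₂ * p 4 + (ξ₂ + ξ₁ * ξ₂ ^ 2) * p 5 + (ξ₁ * ξ₂ ^ 3 + ξ₁ ^ 2 * ξ₂) * p 6,
    p 3 + ξ₁ * ξ₂ * p 4 + (2 * ξ₂ + ξ₁ * ξ₂ ^ 2) * p 5 + (ξ₂ ^ 2 + ξ₁ * ξ₂ ^ 3 + ξ₁ ^ 2 * ξ₂) * p 6,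
    p 1, ξ₁ * p 3 + ξ₁ * p 4 + p 5 + ξ₁ ^ 2 * p 6 - ξ₂ * p 2,
    p 2 + ξ₁ ^ 2 * p 4 + (2 * ξ₁ + ξ₁ ^ 2 * ξ₂) * p 5 + (ξ₁ * ξ₂ + ξ₁ ^ 2 * ξ₂ ^ 2 + ξ₁ ^ 3) * p 6,
    p 2 + ξ₁ ^ 2 * p 4 + (2 * ξ₁ + ξ₁ ^ 2 * ξ₂) * p 5 + (ξ₁ * ξ₂ + ξ₁ ^ 2 * ξ₂ ^ 2 + ξ₁ ^ 3) * p 6,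
    p 4 + ξ₁ * p 6, p 4 + ξ₁ * p 6, p 5 + ξ₂ * p 6]

section Multiplication

variable {A : Type*} [Ring A] [Algebra R A]

/-- The linear combination of the `monomials` with given coefficients. -/
noncomputable def combination (s t : A) : (Fin 24 → R) →ₗ[R] A :=
  Fintype.linearCombination R (monomials s t)

theorem combination_apply (s t : A) (v : Fin 24 → R) :
    combination s t v = ∑ i, v i • monomials s t i := rfl

theorem IsHeckePair.combination_leftS {s t : A} (h : IsHeckePair s t) (v : Fin 24 → R) :
    combination s t (leftS v) = s * combination s t v := by
  simp only [combination_apply, Fin.sum_univ_succ, Fin.sum_univ_zero, monomials,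
    leftS, LinearMap.pi_apply,
    Matrix.cons_val, Fin.isValue, Fin.succ_zero_eq_one, Fin.succ_one_eq_two, Fin.reduceSucc,
    LinearMap.add_apply, LinearMap.sub_apply, LinearMap.smul_apply, coord_apply, smul_eq_mul]
  simp only [mul_add, add_mul, mul_sub, mul_smul_comm, smul_mul_assoc, mul_assoc, mul_one, one_mul,
    mul_zero, zero_mul,
    h.order_left, h.order_left_mul, h.order_right, h.order_right_mul, h.braid,
    h.braid_mul, h.tssts, h.tssts_mul, h.tsstt, h.tsstt_mul, h.ttsst]
  module

theorem IsHeckePair.combination_leftT {s t : A} (h : IsHeckePair s t) (v : Fin 24 → R) :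
    combination s t (leftT v) = t * combination s t v := by
  simp only [combination_apply, Fin.sum_univ_succ, Fin.sum_univ_zero, monomials,
    leftT, LinearMap.pi_apply,
    Matrix.cons_val, Fin.isValue, Fin.succ_zero_eq_one, Fin.succ_one_eq_two, Fin.reduceSucc,
    LinearMap.add_apply, LinearMap.sub_apply, LinearMap.smul_apply, coord_apply, smul_eq_mul]
  simp only [mul_add, add_mul, mul_sub, mul_smul_comm, smul_mul_assoc, mul_assoc, mul_one, one_mul,
    mul_zero, zero_mul,
    h.order_left, h.order_left_mul, h.order_right, h.order_right_mul, h.braid,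
    h.braid_mul, h.tssts, h.tssts_mul, h.tsstt, h.tsstt_mul, h.ttsst]
  module

theorem IsHeckePair.combination_rightS {s t : A} (h : IsHeckePair s t) (v : Fin 24 → R) :
    combination s t (rightS v) = combination s t v * s := by
  simp only [combination_apply, Fin.sum_univ_succ, Fin.sum_univ_zero, monomials,
    rightS, LinearMap.pi_apply,
    Matrix.cons_val, Fin.isValue, Fin.succ_zero_eq_one, Fin.succ_one_eq_two, Fin.reduceSucc,
    LinearMap.add_apply, LinearMap.sub_apply, LinearMap.smul_apply, coord_apply, smul_eq_mul]
  simp only [mul_add, add_mul, mul_sub, mul_smul_comm, smul_mul_assoc, mul_assoc, mul_one, one_mul,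
    mul_zero, zero_mul,
    h.order_left, h.order_left_mul, h.order_right, h.order_right_mul, h.braid,
    h.braid_mul, h.tssts, h.tssts_mul, h.tsstt, h.tsstt_mul, h.ttsst]
  module

theorem IsHeckePair.combination_rightT {s t : A} (h : IsHeckePair s t) (v : Fin 24 → R) :
    combination s t (rightT v) = combination s t v * t := by
  simp only [combination_apply, Fin.sum_univ_succ, Fin.sum_univ_zero, monomials,
    rightT, LinearMap.pi_apply,
    Matrix.cons_val, Fin.isValue, Fin.succ_zero_eq_one, Fin.succ_one_eq_two, Fin.reduceSucc,
    LinearMap.add_apply, LinearMap.sub_apply, LinearMap.smul_apply, coord_apply, smul_eq_mul]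
  simp only [mul_add, add_mul, mul_sub, mul_smul_comm, smul_mul_assoc, mul_assoc, mul_one, one_mul,
    mul_zero, zero_mul,
    h.order_left, h.order_left_mul, h.order_right, h.order_right_mul, h.braid,
    h.braid_mul, h.tssts, h.tssts_mul, h.tsstt, h.tsstt_mul, h.ttsst]
  module

end Multiplication

/-! ### The regular representation and the basis `Bsts`. -/

theorem isHeckePair_gen : IsHeckePair (gen Gen.s) (gen Gen.t) := by
  have order (x : Gen) : gen x * (gen x * gen x) = 1 + ξ₁ • gen x + ξ₂ • (gen x * gen x) := by
    have := RingQuot.mkAlgHom_rel R (Rel.order x)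
    simpa only [gen, map_add, map_smul, map_pow, map_mul, map_one, pow_succ, pow_zero, one_mul,
      mul_assoc] using this
  refine ⟨order _, order _, ?_⟩
  have := RingQuot.mkAlgHom_rel R Rel.braid
  simpa only [gen, map_mul, mul_assoc] using this.symm

theorem leftS_order : leftS * (leftS * leftS) = 1 + ξ₁ • leftS + ξ₂ • (leftS * leftS) := by
  refine LinearMap.ext fun v ↦ funext fun i ↦ ?_
  fin_cases i <;> simp [leftS] <;> ring

set_option maxHeartbeats 1000000 in
theorem leftT_order : leftT * (leftT * leftT) = 1 + ξ₁ • leftT + ξ₂ • (leftT * leftT) := by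
  refine LinearMap.ext fun v ↦ funext fun i ↦ ?_
  fin_cases i <;> simp [leftT] <;> ring

set_option maxHeartbeats 1000000 in
theorem left_braid : leftT * (leftS * leftT) = leftS * (leftT * leftS) := by
  refine LinearMap.ext fun v ↦ funext fun i ↦ ?_
  fin_cases i <;> simp [leftS, leftT] <;> ring

theorem isHeckePair_left : IsHeckePair leftS leftT :=
  ⟨leftS_order, leftT_order, left_braid⟩

/-- An algebra hom out of `H` from a pair satisfying the relations. -/
noncomputable def liftPair {A : Type*} [Ring A] [Algebra R A] {s t : A} (h : IsHeckePair s t) :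
    H →ₐ[R] A :=
  RingQuot.liftAlgHom R ⟨FreeAlgebra.lift R fun x ↦ Gen.casesOn x s t, by
    intro x y hxy
    cases hxy with
    | order x =>
      cases x
      · simpa [pow_succ, mul_assoc] using h.order_left
      · simpa [pow_succ, mul_assoc] using h.order_right
    | braid => simpa [mul_assoc] using h.braid.symm⟩

section Lift

variable {A : Type*} [Ring A] [Algebra R A] {s t : A} (h : IsHeckePair s t)

@[simp]
theorem liftPair_gen_s : liftPair h (gen Gen.s) = s := by
  simp [liftPair, gen]

@[simp]
theorem liftPair_gen_t : liftPair h (gen Gen.t) = t := by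
  simp [liftPair, gen]

end Lift

theorem adjoin_range_gen : Algebra.adjoin R (Set.range gen) = ⊤ := by
  have : Set.range gen = RingQuot.mkAlgHom R Rel '' Set.range (FreeAlgebra.ι R) := by
    rw [← Set.range_comp]
    rfl
  rw [this, ← AlgHom.map_adjoin, FreeAlgebra.adjoin_range_ι, Algebra.map_top,
    AlgHom.range_eq_top]
  exact RingQuot.mkAlgHom_surjective R Rel

theorem Bsts_eq_monomials : Bsts = monomials (gen Gen.s) (gen Gen.t) := by
  have h := isHeckePair_gen
  funext i
  fin_cases i <;> simp [Bsts, wordsSts, T, monomials, h.braid, h.braid_mul, h.tssts, mul_assoc]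

/-- The left regular representation of `H` in coordinates. -/
noncomputable def regular : H →ₐ[R] Module.End R (Fin 24 → R) := liftPair isHeckePair_left

/-- The linear combination of `B_sts` with given coefficients. -/
noncomputable def combSts : (Fin 24 → R) →ₗ[R] H := combination (gen Gen.s) (gen Gen.t)

theorem combSts_apply (v : Fin 24 → R) : combSts v = ∑ i, v i • Bsts i := by
  rw [Bsts_eq_monomials]
  rfl

/-- The identity is multiplicative and additive in `z`, so it need only be checked on the
generators. -/
theorem combSts_regular (z : H) (v : Fin 24 → R) : combSts (regular z v) = z * combSts v := by
  have hz : z ∈ Algebra.adjoin R (Set.range gen) := adjoin_range_gen ▸ Algebra.mem_top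
  induction hz using Algebra.adjoin_induction generalizing v with
  | mem x hx =>
    obtain ⟨x, rfl⟩ := hx
    cases x
    · rw [regular, liftPair_gen_s]
      exact isHeckePair_gen.combination_leftS v
    · rw [regular, liftPair_gen_t]
      exact isHeckePair_gen.combination_leftT v
  | algebraMap r => simp [Algebra.algebraMap_eq_smul_one]
  | add x y _ _ hx hy => simp [add_mul, hx, hy]
  | mul x y _ _ hx hy => simp [mul_assoc, hx, hy]

theorem combSts_single (i : Fin 24) : combSts (Pi.single i 1) = Bsts i := by
  simp [combSts_apply, Pi.single_apply]

-- The normal forms are closed under deleting the first letter. These identities and those of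
-- `leftT_single` form a tree rooted at index 0 that reaches each other index once.
set_option maxHeartbeats 1000000 in
theorem leftS_single :
    leftS (Pi.single 0 1) = Pi.single 1 1 ∧
    leftS (Pi.single 1 1) = Pi.single 3 1 ∧
    leftS (Pi.single 2 1) = Pi.single 5 1 ∧
    leftS (Pi.single 4 1) = Pi.single 7 1 ∧
    leftS (Pi.single 5 1) = Pi.single 9 1 ∧
    leftS (Pi.single 7 1) = Pi.single 11 1 ∧
    leftS (Pi.single 8 1) = Pi.single 13 1 ∧
    leftS (Pi.single 19 1) = Pi.single 15 1 ∧
    leftS (Pi.single 14 1) = Pi.single 16 1 ∧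
    leftS (Pi.single 16 1) = Pi.single 17 1 ∧
    leftS (Pi.single 6 1) = Pi.single 18 1 ∧
    leftS (Pi.single 10 1) = Pi.single 19 1 ∧
    leftS (Pi.single 18 1) = Pi.single 20 1 ∧
    leftS (Pi.single 13 1) = Pi.single 21 1 ∧
    leftS (Pi.single 12 1) = Pi.single 22 1 ∧
    leftS (Pi.single 22 1) = Pi.single 23 1 := by
  refine ⟨?_, ?_, ?_, ?_, ?_, ?_, ?_, ?_, ?_, ?_, ?_, ?_, ?_, ?_, ?_, ?_⟩ <;>
    refine funext fun k ↦ ?_ <;> fin_cases k <;> simp [leftS, Pi.single_apply]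

set_option maxHeartbeats 1000000 in
theorem leftT_single :
    leftT (Pi.single 0 1) = Pi.single 2 1 ∧
    leftT (Pi.single 2 1) = Pi.single 4 1 ∧
    leftT (Pi.single 1 1) = Pi.single 6 1 ∧
    leftT (Pi.single 6 1) = Pi.single 8 1 ∧
    leftT (Pi.single 3 1) = Pi.single 10 1 ∧
    leftT (Pi.single 10 1) = Pi.single 12 1 ∧
    leftT (Pi.single 9 1) = Pi.single 14 1 := by
  refine ⟨?_, ?_, ?_, ?_, ?_, ?_, ?_⟩ <;>
    refine funext fun k ↦ ?_ <;> fin_cases k <;> simp [leftT, Pi.single_apply]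

theorem regular_combSts (v : Fin 24 → R) : regular (combSts v) (Pi.single 0 1) = v := by
  suffices h : ∀ i, regular (Bsts i) (Pi.single 0 1) = Pi.single i 1 by
    rw [combSts_apply, map_sum, LinearMap.sum_apply]
    simp only [map_smul, LinearMap.smul_apply, h]
    exact (pi_eq_sum_univ' v).symm
  have hS : regular (gen Gen.s) = leftS := liftPair_gen_s _
  have hT : regular (gen Gen.t) = leftT := liftPair_gen_t _
  rw [Bsts_eq_monomials]
  intro i
  fin_cases i <;>
    simp [monomials, hS, hT, leftS_single, leftT_single]

theorem combSts_injective : Function.Injective combSts := fun v w h ↦ by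
  rw [← regular_combSts v, h, regular_combSts]

theorem Bsts_zero : Bsts 0 = 1 := by
  simp [Bsts, wordsSts, T]

theorem combSts_surjective : Function.Surjective combSts := fun z ↦
  ⟨regular z (Pi.single 0 1), by rw [combSts_regular, combSts_single, Bsts_zero, mul_one]⟩

theorem linearIndependent_Bsts : LinearIndependent R Bsts := by
  rw [Fintype.linearIndependent_iffₛ]
  intro v w h
  rw [← combSts_apply, ← combSts_apply] at h
  exact congrFun (combSts_injective h)

theorem span_Bsts : Submodule.span R (Set.range Bsts) = ⊤ := by
  rw [eq_top_iff]
  intro z _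
  obtain ⟨v, rfl⟩ := combSts_surjective z
  rw [combSts_apply]
  exact Submodule.sum_mem _ fun i _ ↦ Submodule.smul_mem _ _ (Submodule.subset_span ⟨i, rfl⟩)

/-! ### The centre as the solution space of a linear system. -/

theorem mem_center_iff_gen (z : H) :
    z ∈ Subalgebra.center R H ↔
      gen Gen.s * z = z * gen Gen.s ∧ gen Gen.t * z = z * gen Gen.t := by
  refine ⟨fun h ↦ ⟨Subalgebra.mem_center_iff.1 h _, Subalgebra.mem_center_iff.1 h _⟩,
    fun ⟨hs, ht⟩ ↦ Subalgebra.mem_center_iff.2 fun x ↦ ?_⟩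
  have hx : x ∈ Algebra.adjoin R (Set.range gen) := adjoin_range_gen ▸ Algebra.mem_top
  induction hx using Algebra.adjoin_induction with
  | mem x hx =>
    obtain ⟨x, rfl⟩ := hx
    cases x
    · exact hs
    · exact ht
  | algebraMap r => exact Algebra.commutes r z
  | add x y _ _ hx hy => rw [add_mul, mul_add, hx, hy]
  | mul x y _ _ hx hy => rw [mul_assoc, hy, ← mul_assoc, hx, mul_assoc]

theorem combSts_mem_center_iff (v : Fin 24 → R) :
    combSts v ∈ Subalgebra.center R H ↔ leftS v = rightS v ∧ leftT v = rightT v := by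
  have h := isHeckePair_gen
  rw [mem_center_iff_gen, combSts, ← h.combination_leftS, ← h.combination_rightS,
    ← h.combination_leftT, ← h.combination_rightT]
  exact and_congr combSts_injective.eq_iff combSts_injective.eq_iff

theorem leftS_centralCoords (p : Fin 7 → R) :
    leftS (centralCoords p) = rightS (centralCoords p) := by
  funext i
  fin_cases i <;> simp [leftS, rightS, centralCoords] <;> ring

theorem leftT_centralCoords (p : Fin 7 → R) :
    leftT (centralCoords p) = rightT (centralCoords p) := by
  funext i
  fin_cases i <;> simp [leftT, rightT, centralCoords] <;> ring

/-- The positions 0, 17, 1, 6, 3, 7, 11 are ones where `centralCoords p` is just `p 0`, …, `p 6`.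
Seventeen of the 48 equations determine the remaining entries, with multipliers in `R`, so the
solution is integral and not merely valid over the fraction field. -/
theorem eq_centralCoords {v : Fin 24 → R} (hs : leftS v = rightS v) (ht : leftT v = rightT v) :
    v = centralCoords ![v 0, v 17, v 1, v 6, v 3, v 7, v 11] := by
  have hs2 : v 9 =
      v 10 := by
    simpa [leftS, rightS] using congrFun hs 2
  have hs4 : v 11 =
      v 12 := by
    simpa [leftS, rightS] using congrFun hs 4
  have hs6 : v 20 =
      v 2 + ξ₁ * v 10 := by
    simpa [leftS, rightS] using congrFun hs 6
  have hs7 : v 4 + ξ₁ * v 11 =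
      v 22 := by
    simpa [leftS, rightS] using congrFun hs 7
  have hs10 : v 15 =
      v 6 + ξ₂ * v 10 := by
    simpa [leftS, rightS] using congrFun hs 10
  have hs11 : v 7 + ξ₂ * v 11 =
      v 23 := by
    simpa [leftS, rightS] using congrFun hs 11
  have hs15 : ξ₂ * v 15 + v 19 =
      ξ₂ * v 15 + v 20 := by
    simpa [leftS, rightS] using congrFun hs 15
  have hs18 : v 6 + ξ₁ * v 20 =
      v 5 + ξ₁ * v 19 := by
    simpa [leftS, rightS] using congrFun hs 18
  have hs21 : v 13 + ξ₂ * v 21 =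
      v 11 + ξ₁ * v 23 := by
    simpa [leftS, rightS] using congrFun hs 21
  have hs23 : v 22 + ξ₂ * v 23 =
      v 21 + ξ₂ * v 23 := by
    simpa [leftS, rightS] using congrFun hs 23
  have ht1 : v 8 =
      v 7 := by
    simpa [leftT, rightT] using congrFun ht 1
  have ht5 : v 19 =
      v 1 + ξ₁ * v 7 + ξ₁ ^ 2 * v 22 + (ξ₁ + ξ₁ ^ 2 * ξ₂) * v 23 := by
    simpa [leftT, rightT] using congrFun ht 5
  have ht8 : v 6 + ξ₂ * v 8 - ξ₁ * v 11 - ξ₁ ^ 2 * v 23 =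
      v 16 - ξ₁ * v 14 - ξ₂ * v 23 := by
    simpa [leftT, rightT] using congrFun ht 8
  have ht9 : ξ₁ * v 14 + v 22 =
      v 3 + ξ₁ * v 11 + ξ₁ * v 12 + ξ₁ * ξ₂ * v 22 + (ξ₁ * ξ₂ ^ 2 + ξ₁ ^ 2) * v 23 := by
    simpa [leftT, rightT] using congrFun ht 9
  have ht11 : v 23 =
      v 9 + ξ₂ * v 11 - ξ₁ * v 22 - ξ₁ * ξ₂ * v 23 := by
    simpa [leftT, rightT] using congrFun ht 11
  have ht20 : v 7 + ξ₁ * v 16 + ξ₁ * v 22 =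
      v 18 + ξ₂ * v 20 := by
    simpa [leftT, rightT] using congrFun ht 20
  have ht21 : v 11 + ξ₁ * v 23 =
      v 14 - ξ₂ * v 22 - ξ₂ ^ 2 * v 23 := by
    simpa [leftT, rightT] using congrFun ht 21
  funext i
  fin_cases i <;> simp only [centralCoords, Matrix.cons_val, Fin.reduceFinMk,
    Fin.zero_eta, Fin.mk_one, Fin.isValue]
  · linear_combination ξ₁ * hs2 + ht5 + ξ₁ * ht11 - hs6 - hs15
  · linear_combination hs7 + ht9 + ξ₁ * ht21 - ξ₁ * hs4
  · linear_combination -ξ₁ * hs15 - hs18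
  · linear_combination ht1
  · linear_combination ξ₁ * ht9 + ξ₁ ^ 2 * ht21 - ξ₁ ^ 2 * hs4 - (1 + ξ₁ * ξ₂) * hs11 - ht11
  · linear_combination ξ₁ * ht9 + ξ₁ ^ 2 * ht21 - hs2 - ξ₁ ^ 2 * hs4 - (1 + ξ₁ * ξ₂) * hs11 - ht11
  · linear_combination -hs4
  · linear_combination ξ₁ * ξ₂ * hs4 + hs21 + ξ₂ * hs23 - ξ₁ * hs11 - ξ₂ * ht9 - ξ₁ * ξ₂ * ht21
  · linear_combination ξ₂ * ht9 + (-1 + ξ₁ * ξ₂) * ht21 - ξ₁ * ξ₂ * hs4 - (ξ₂ ^ 2 + ξ₁) * hs11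
  · linear_combination hs10 + ξ₁ * ξ₂ * ht9 + ξ₁ ^ 2 * ξ₂ * ht21 - ξ₂ * hs2 -
      ξ₁ ^ 2 * ξ₂ * hs4 - (ξ₂ + ξ₁ * ξ₂ ^ 2) * hs11 - ξ₂ * ht11
  · linear_combination ξ₂ * ht1 + ξ₁ * ξ₂ * ht9 + (-ξ₁ + ξ₁ ^ 2 * ξ₂) * ht21 -
      ξ₁ ^ 2 * ξ₂ * hs4 - (ξ₂ + ξ₁ * ξ₂ ^ 2) * hs11 - ht8
  · linear_combination ξ₂ * hs15 + ξ₁ * ξ₂ * ht1 + ξ₁ * ht9 - ξ₁ ^ 2 * hs4 - ξ₂ * ht5 -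
      ξ₁ * ht8 - ht20
  · linear_combination ht5 + ξ₁ ^ 2 * ht9 + ξ₁ ^ 3 * ht21 - ξ₁ ^ 3 * hs4 - (ξ₁ + ξ₁ ^ 2 * ξ₂) * hs11
  · linear_combination ht5 + ξ₁ ^ 2 * ht9 + ξ₁ ^ 3 * ht21 - ξ₁ ^ 3 * hs4 -
      (ξ₁ + ξ₁ ^ 2 * ξ₂) * hs11 - hs15
  · linear_combination ht9 + ξ₁ * ht21 - ξ₁ * hs4 - hs23
  · linear_combination ht9 + ξ₁ * ht21 - ξ₁ * hs4
  · linear_combination -hs11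

theorem combSts_centralCoords (p : Fin 7 → R) : combSts (centralCoords p) = ∑ i, p i • b i := by
  have h := isHeckePair_gen
  simp [combSts, combination_apply, Fin.sum_univ_succ, monomials, centralCoords, b, b₁, b₂, b₃, b₄,
    b₅, b₆, b₇, T, h.braid, h.braid_mul, h.tssts, mul_assoc]
  generalize gen Gen.s = s, gen Gen.t = t
  module

end HeckeG4

theorem mainTheorem2 :
    (LinearIndependent HeckeG4.R HeckeG4.Bsts ∧
      Submodule.span HeckeG4.R (Set.range HeckeG4.Bsts) = ⊤) ∧
    (LinearIndependent HeckeG4.R HeckeG4.b ∧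
      Submodule.span HeckeG4.R (Set.range HeckeG4.b) =
        Subalgebra.toSubmodule (Subalgebra.center HeckeG4.R HeckeG4.H)) := by
  open HeckeG4 in
  refine ⟨⟨linearIndependent_Bsts, span_Bsts⟩, ?_, le_antisymm ?_ fun z hz ↦ ?_⟩
  · rw [Fintype.linearIndependent_iffₛ]
    intro p q hpq i
    rw [← combSts_centralCoords, ← combSts_centralCoords] at hpq
    have h := congrFun (combSts_injective hpq)
    fin_cases i
    -- At these basis positions the coefficients of the combination are the bare parameters.
    exacts [h 0, h 17, h 1, h 6, h 3, h 7, h 11]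
  · rw [Submodule.span_le]
    rintro _ ⟨i, rfl⟩
    have : b i = combSts (centralCoords (Pi.single i 1)) := by
      simp [combSts_centralCoords, Pi.single_apply]
    rw [this]
    exact (combSts_mem_center_iff _).2 ⟨leftS_centralCoords _, leftT_centralCoords _⟩
  · obtain ⟨v, rfl⟩ := combSts_surjective z
    obtain ⟨hs, ht⟩ := (combSts_mem_center_iff v).1 hz
    rw [eq_centralCoords hs ht, combSts_centralCoords]
    exact Submodule.sum_mem _ fun i _ ↦ Submodule.smul_mem _ _ (Submodule.subset_span ⟨i, rfl⟩)
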